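/- A sequence over a finite commutative ring $G$ is a finite unordered sequence of elements of $G$ with repetition allowed; its length $|S|$ counts multiplicity, and for $S=(g_1,\dots,g_n)$ put $e_m(S)=\sum_{1\le i_1<\dots<i_m\le n} g_{i_1}\cdots g_{i_m}$ (so $e_m(S)=0$ if $n<m$). Let $\mathrm{EGZ}_t(G,m)$ be the smallest positive integer $z$ such that every sequence $S$ over $G$ with $|S|\ge z$ has a subsequence $S'$ of length exactly $t$ with $e_m(S')=0$ (and $\infty$ if there is no such $z$). Let $D_m(G)$ be the smallest positive integer $z$ such that every sequence $S$ over $G$ with $|S|\ge z$ has a subsequence $S'$ of length at least $m$ with $e_m(S')=0$ (and $\infty$ if there is no such $z$). **Theorem.** Let $k$ be an odd positive integer and $\mathbb{Z}_k=\mathbb{Z}/k\mathbb{Z}$. 1. If $\ell\ge 1$ is an integer and $r$ is a positive integer with $r\mid k$ and $k\mid r^2$, then $\mathrm{EGZ}_{\ell k}(\mathbb{Z}_k,2)\le(\ell+1)k+2r-3$. In particular, if $k=r^2$ with $r$ a positive integer, then $\mathrm{EGZ}_k(\mathbb{Z}_k,2)\le 2r^2+2r-3$. 2. $\mathrm{EGZ}_k(\mathbb{Z}_k,2)\ge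 k+D_2(\mathbb{Z}_k)-2$. 3. If $k=p$ is an odd prime, then $\mathrm{EGZ}_p(\mathbb{Z}_p,2)\ge 2p-1$; if moreover $p\equiv 3\pmod 4$, then $\mathrm{EGZ}_p(\mathbb{Z}_p,2)\ge 2p$. -/

import Mathlib

/-- The `m`-th degree Erdős–Ginzburg–Ziv constant `EGZ_t(R, m)`: the smallest positive integer `z`
such that every sequence over `R` (unordered, with repetition, i.e. a multiset) of length at least
`z` has a subsequence `S'` of length `t` with `e_m(S') = 0`; it is `⊤` if there is no such `z`. -/
noncomputable def egzConst (t : ℕ) (R : Type*) [CommRing R] (m : ℕ) : ℕ∞ :=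
  sInf ((fun z : ℕ => (z : ℕ∞)) ''
    {z : ℕ | 0 < z ∧ ∀ S : Multiset R, z ≤ S.card →
      ∃ S' ≤ S, S'.card = t ∧ S'.esymm m = 0})

/-- The `m`-th degree Davenport constant `D_m(R)`: the smallest positive integer `z` such that every
sequence over `R` of length at least `z` has a subsequence `S'` of length at least `m` with
`e_m(S') = 0`; it is `⊤` if there is no such `z`. -/
noncomputable def davenportConst (m : ℕ) (R : Type*) [CommRing R] : ℕ∞ :=
  sInf ((fun z : ℕ => (z : ℕ∞)) ''
    {z : ℕ | 0 < z ∧ ∀ S : Multiset R, z ≤ S.card →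
      ∃ S' ≤ S, m ≤ S'.card ∧ S'.esymm m = 0})

/-! For the upper bound, use `S.sum ^ 2 = (sum of squares) + 2 e₂` with 2 invertible. A block of `k`
terms has `e₂ = 0` once its sum is divisible by `r` (so its square is divisible by `k`) and its sum
of squares by `k`. Applied to the pairs `(a, a ^ 2)`, this is a zero-sum problem in `ℤ/r × ℤ/k`,
where `2r + 2k - 3` pairs suffice. That bound follows from Erdős–Ginzburg–Ziv when `r = 1` and from
Reiher's theorem, one prime factor of `r` at a time. Merging `ℓ` disjoint blocks costs `(ℓ - 1)k`
further terms.

Reiher's theorem comes from congruences mod `p` for the numbers of zero-sum subsets of sizes near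
multiples of `p`. All of them are instances of one polynomial identity; together with a double count
they force `2 = 0` if no zero-sum `p`-subset exists.

For the lower bounds, padding with `k - 2` zeros leaves `e₂` unchanged and turns `EGZ` into `D₂`.
Sequences of `p - 1` ones and one or two halves then bound `D₂` from below. -/

section

open Finset

/-! ### The polynomial method and zero-sum counts -/

/-- The alternating sum over the subsets of `J` of a polynomial of total degree less than `#J`,
evaluated at indicator vectors, vanishes. -/
theorem sum_powerset_neg_one_pow_card_mul_eval_eq_zero {ι R : Type*} [DecidableEq ι] [CommRing R]
    (P : MvPolynomial ι R) (J : Finset ι) (h : P.totalDegree < #J) :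
    ∑ I ∈ J.powerset, (-1) ^ #I * MvPolynomial.eval (fun i => if i ∈ I then (1 : R) else 0) P
      = 0 := by
  simp_rw [MvPolynomial.eval_eq, mul_sum]
  rw [sum_comm]
  refine sum_eq_zero fun d hd => ?_
  -- The degree bound makes each monomial miss some `x ∈ J`; adding or deleting `x` then flips the
  -- sign and nothing else.
  obtain ⟨x, hxJ, hxd⟩ : ∃ x ∈ J, x ∉ d.support := by
    by_contra! hsub
    have h1 : #J ≤ #d.support := card_le_card hsub
    have h2 : #d.support ≤ d.sum fun _ e => e := by
      rw [Finsupp.sum, card_eq_sum_ones]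
      exact sum_le_sum fun i hi => Nat.one_le_iff_ne_zero.2 (Finsupp.mem_support_iff.1 hi)
    have := MvPolynomial.le_totalDegree hd
    omega
  rw [← insert_erase hxJ, sum_powerset_insert (notMem_erase x J), ← sum_add_distrib]
  refine sum_eq_zero fun I hI => ?_
  have hxI : x ∉ I := fun hx => notMem_erase x J (mem_powerset.1 hI hx)
  have hprod : ∏ i ∈ d.support, (if i ∈ insert x I then (1 : R) else 0) ^ d i
      = ∏ i ∈ d.support, (if i ∈ I then (1 : R) else 0) ^ d i := by
    refine prod_congr rfl fun i hi => ?_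
    have : i ≠ x := by rintro rfl; exact hxd hi
    simp [this]
  rw [hprod, card_insert_of_notMem hxI]
  ring

/-- The number of subsets of `J` of size `n` over which `f` sums to zero. -/
def zeroSumCount {ι G : Type*} [AddCommMonoid G] [DecidableEq G] (f : ι → G) (J : Finset ι)
    (n : ℕ) : ℕ :=
  ((J.powersetCard n).filter fun I => ∑ i ∈ I, f i = 0).card

theorem zeroSumCount_eq_zero_of_card_lt {ι G : Type*} [AddCommMonoid G] [DecidableEq G]
    {f : ι → G} {J : Finset ι} {n : ℕ} (h : #J < n) : zeroSumCount f J n = 0 := by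
  simp [zeroSumCount, powersetCard_eq_empty.2 h]

@[simp]
theorem zeroSumCount_zero {ι G : Type*} [AddCommMonoid G] [DecidableEq G] (f : ι → G)
    (J : Finset ι) : zeroSumCount f J 0 = 1 := by
  simp [zeroSumCount, filter_singleton]

theorem zeroSumCount_eq_zero_iff {ι G : Type*} [AddCommMonoid G] [DecidableEq G] {f : ι → G}
    {J : Finset ι} {n : ℕ} :
    zeroSumCount f J n = 0 ↔ ∀ I ⊆ J, #I = n → ∑ i ∈ I, f i ≠ 0 := by
  simp [zeroSumCount, filter_eq_empty_iff, mem_powersetCard]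

theorem zeroSumCount_eq_zero_of_subset {ι G : Type*} [AddCommMonoid G] [DecidableEq G] {f : ι → G}
    {J K : Finset ι} {n : ℕ} (hKJ : K ⊆ J) (h : zeroSumCount f J n = 0) :
    zeroSumCount f K n = 0 :=
  zeroSumCount_eq_zero_iff.2 fun I hI => zeroSumCount_eq_zero_iff.1 h I (hI.trans hKJ)

/-- Each zero-sum subset of size `n` lies in `(#J - n).choose (m - n)` subsets of size `m`. -/
theorem sum_zeroSumCount_powersetCard {ι G : Type*} [AddCommMonoid G] [DecidableEq G]
    [DecidableEq ι] (f : ι → G) (J : Finset ι) {m n : ℕ} (hnm : n ≤ m) :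
    ∑ I ∈ J.powersetCard m, zeroSumCount f I n
      = (#J - n).choose (m - n) * zeroSumCount f J n := by
  have h1 : ∀ I ∈ J.powersetCard m, zeroSumCount f I n
      = #{S ∈ (J.powersetCard n).filter (fun S => ∑ i ∈ S, f i = 0) | S ⊆ I} := by
    intro I hI
    rw [zeroSumCount]
    congr 1
    ext S
    have := (mem_powersetCard.1 hI).1
    simp only [mem_filter, mem_powersetCard]
    constructor
    · rintro ⟨⟨h, h'⟩, h''⟩; exact ⟨⟨⟨h.trans this, h'⟩, h''⟩, h⟩
    · rintro ⟨⟨⟨h, h'⟩, h''⟩, h3⟩; exact ⟨⟨h3, h'⟩, h''⟩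
  rw [sum_congr rfl h1]
  simp_rw [card_filter _ _]
  rw [sum_comm, sum_congr rfl (g := fun _ => (#J - n).choose (m - n))]
  · rw [sum_const, smul_eq_mul, mul_comm, zeroSumCount]
  · intro S hS
    obtain ⟨hSJ, hSn⟩ := mem_powersetCard.1 (mem_filter.1 hS).1
    rw [← card_filter, ← hSn]
    exact card_filter_powersetCard_subset _ _ _ hSJ (hSn ▸ hnm)

section Prime

variable {p : ℕ} [Fact p.Prime] {ι : Type*} [DecidableEq ι]

theorem one_sub_pow_card_sub_one (x : ZMod p) : 1 - x ^ (p - 1) = if x = 0 then 1 else 0 := by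
  split_ifs with h
  · have := (Fact.out : p.Prime).two_le
    rw [h, zero_pow (by omega), sub_zero]
  · rw [ZMod.pow_card_sub_one_eq_one h, sub_self]

/-- Alternating sums of zero-sum counts, weighted by a polynomial of low degree, vanish. -/
theorem sum_neg_one_pow_mul_zeroSumCount (f : ι → ZMod p × ZMod p) (J : Finset ι)
    (Q : Polynomial (ZMod p)) (h : Q.natDegree + 2 * (p - 1) < #J) :
    ∑ n ∈ range (#J + 1), (-1) ^ n * Q.eval (n : ZMod p) * (zeroSumCount f J n : ZMod p) = 0 := by
  let lin (c : ι → ZMod p) : MvPolynomial ι (ZMod p) :=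
    ∑ i ∈ J, MvPolynomial.C (c i) * MvPolynomial.X i
  have hdeg (c) : (lin c).totalDegree ≤ 1 := by
    refine MvPolynomial.totalDegree_finsetSum_le fun i _ => ?_
    refine (MvPolynomial.totalDegree_mul _ _).trans ?_
    simp
  have heval (c) (I : Finset ι) (hI : I ⊆ J) :
      MvPolynomial.eval (fun i => if i ∈ I then (1 : ZMod p) else 0) (lin c) = ∑ i ∈ I, c i := by
    simp [lin, inter_eq_right.2 hI]
  -- At the indicator of `I ⊆ J`, `lin 1` is `#I`, and by Fermat the other two factors detect that
  -- both coordinate sums vanish.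
  let P : MvPolynomial ι (ZMod p) := Polynomial.aeval (lin 1) Q *
    ((1 - lin (fun i => (f i).1) ^ (p - 1)) * (1 - lin (fun i => (f i).2) ^ (p - 1)))
  have hpow (c) : (1 - lin c ^ (p - 1)).totalDegree ≤ p - 1 := by
    refine (MvPolynomial.totalDegree_sub _ _).trans (max_le (by simp) ?_)
    refine (MvPolynomial.totalDegree_pow _ _).trans ?_
    exact (Nat.mul_le_mul_left _ (hdeg c)).trans (by simp)
  have hQ : (Polynomial.aeval (lin 1) Q).totalDegree ≤ Q.natDegree := by
    rw [Polynomial.aeval_eq_sum_range]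
    refine MvPolynomial.totalDegree_finsetSum_le fun i hi => ?_
    refine (MvPolynomial.totalDegree_smul_le _ _).trans ?_
    refine (MvPolynomial.totalDegree_pow _ _).trans ?_
    refine (Nat.mul_le_mul_left _ (hdeg 1)).trans ?_
    have := mem_range.1 hi
    omega
  have hP : P.totalDegree < #J := by
    have h1 := MvPolynomial.totalDegree_mul (Polynomial.aeval (lin 1) Q)
      ((1 - lin (fun i => (f i).1) ^ (p - 1)) * (1 - lin (fun i => (f i).2) ^ (p - 1)))
    have h2 := MvPolynomial.totalDegree_mul
      (1 - lin (fun i => (f i).1) ^ (p - 1)) (1 - lin (fun i => (f i).2) ^ (p - 1))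
    have h3 := hpow (fun i => (f i).1)
    have h4 := hpow (fun i => (f i).2)
    change P.totalDegree ≤ _ at h1
    omega
  have key := sum_powerset_neg_one_pow_card_mul_eval_eq_zero P J hP
  rw [sum_powerset] at key
  rw [← key]
  refine sum_congr rfl fun n _ => ?_
  rw [zeroSumCount, card_filter, Nat.cast_sum, mul_sum]
  refine sum_congr rfl fun I hI => ?_
  obtain ⟨hIJ, rfl⟩ := mem_powersetCard.1 hI
  have e1 : MvPolynomial.eval (fun i => if i ∈ I then (1 : ZMod p) else 0) P
      = Q.eval (#I : ZMod p) * (if ∑ i ∈ I, f i = 0 then 1 else 0) := by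
    simp only [P, map_mul, map_sub, map_one, map_pow, heval _ I hIJ, one_sub_pow_card_sub_one]
    congr 1
    · rw [← MvPolynomial.coe_aeval_eq_eval, RingHom.coe_coe, ← Polynomial.aeval_algHom_apply,
        show MvPolynomial.aeval (fun i => if i ∈ I then (1 : ZMod p) else 0) (lin 1) = (#I : ZMod p)
          from (heval 1 I hIJ).trans (by simp)]
      simp
    · have : ∑ i ∈ I, f i = 0 ↔ ∑ i ∈ I, (f i).1 = 0 ∧ ∑ i ∈ I, (f i).2 = 0 := by
        rw [Prod.ext_iff, Prod.fst_sum, Prod.snd_sum, Prod.fst_zero, Prod.snd_zero]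
      simp only [this, ite_and, ite_mul, one_mul, zero_mul]
  rw [e1]
  push_cast
  ring

theorem sum_range_ite_mod_eq {R : Type*} [AddCommMonoid R] (g : ℕ → R) {q s : ℕ} (hs : s < q)
    (m : ℕ) :
    ∑ n ∈ range (m * q), (if n % q = s then g n else 0) = ∑ j ∈ range m, g (j * q + s) := by
  induction m with
  | zero => simp
  | succ m ih =>
    rw [Nat.succ_mul, sum_range_add, ih, sum_range_succ]
    congr 1
    rw [sum_eq_single_of_mem s (mem_range.2 hs)]
    · simp [Nat.mod_eq_of_lt hs]
    · intro b hb hbs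
      simp [Nat.mod_eq_of_lt (mem_range.1 hb), hbs]

end Prime

/-- Lets the range run up to a full multiple of `p`, as `sum_range_ite_mod_eq` requires. -/
theorem sum_range_zeroSumCount_of_card_lt {ι R G : Type*} [CommRing R] [AddCommMonoid G]
    [DecidableEq G] (f : ι → G) {J : Finset ι} {N : ℕ} (hN : #J < N) (g : ℕ → R) :
    ∑ n ∈ range (#J + 1), g n * (zeroSumCount f J n : R)
      = ∑ n ∈ range N, g n * (zeroSumCount f J n : R) := by
  refine sum_subset (range_subset_range.2 hN) fun n _ hn => ?_
  rw [zeroSumCount_eq_zero_of_card_lt (by simpa using hn), Nat.cast_zero, mul_zero]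

/-! ### Reiher's congruences and the Kemnitz conjecture -/

section Prime

variable {p : ℕ} [Fact p.Prime] {ι : Type*} [DecidableEq ι]

theorem natCast_eq_zero_iff_mod (n : ℕ) : (n : ZMod p) = 0 ↔ n % p = 0 := by
  rw [ZMod.natCast_eq_zero_iff, Nat.dvd_iff_mod_eq_zero]

theorem natCast_add_one_eq_zero_iff_mod (n : ℕ) : (n : ZMod p) + 1 = 0 ↔ n % p = p - 1 := by
  have hp := (Fact.out : p.Prime).two_le
  have h1 : n % p < p := Nat.mod_lt _ (by omega)
  rw [← Nat.cast_succ, natCast_eq_zero_iff_mod, Nat.succ_eq_add_one, Nat.add_mod,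
    Nat.mod_eq_of_lt hp]
  constructor
  · intro h
    by_contra hne
    rw [Nat.mod_eq_of_lt (by omega)] at h
    omega
  · intro h
    rw [h, Nat.sub_add_cancel (by omega), Nat.mod_self]

/-- The weight `1 - X ^ (p - 1)` keeps only the sizes divisible by `p`, and `(-1) ^ p = -1` produces
the signs. The total degree is `3p - 3`. -/
theorem zeroSumCount_alternating (hp2 : p ≠ 2) (f : ι → ZMod p × ZMod p) {J : Finset ι}
    (hJ : 3 * p - 2 ≤ #J) (hJ' : #J < 4 * p) :
    (1 : ZMod p) - zeroSumCount f J p + zeroSumCount f J (2 * p) - zeroSumCount f J (3 * p)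
      = 0 := by
  have hp : p.Prime := Fact.out
  have hp0 := hp.two_le
  have hodd : (-1 : ZMod p) ^ p = -1 := (hp.odd_of_ne_two hp2).neg_one_pow
  have hdeg : (1 - Polynomial.X ^ (p - 1) : Polynomial (ZMod p)).natDegree ≤ p - 1 := by
    compute_degree
  have key := sum_neg_one_pow_mul_zeroSumCount f J (1 - Polynomial.X ^ (p - 1)) (by omega)
  rw [sum_range_zeroSumCount_of_card_lt f hJ' (fun n => (-1) ^ n *
    (1 - Polynomial.X ^ (p - 1) : Polynomial (ZMod p)).eval (n : ZMod p))] at key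
  have h2 := sum_range_ite_mod_eq
    (fun n => (-1) ^ n * (zeroSumCount f J n : ZMod p)) hp.pos 4
  simp only [Polynomial.eval_sub, Polynomial.eval_one, Polynomial.eval_pow, Polynomial.eval_X,
    one_sub_pow_card_sub_one, natCast_eq_zero_iff_mod, mul_ite, mul_one, mul_zero, ite_mul,
    zero_mul] at key
  rw [h2] at key
  simp only [sum_range_succ, range_zero, sum_empty, zero_add, add_zero,
    mul_zero, mul_comm _ p, pow_mul, hodd] at key
  rw [zeroSumCount_zero] at key
  rw [← key, mul_comm 2 p, mul_comm 3 p]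
  push_cast
  ring_nf

theorem zeroSumCount_alternating_sub_one (hp2 : p ≠ 2) (f : ι → ZMod p × ZMod p) {J : Finset ι}
    (hJ : 3 * p - 2 ≤ #J) (hJ' : #J < 4 * p - 1) :
    (zeroSumCount f J (p - 1) : ZMod p) - zeroSumCount f J (2 * p - 1)
      + zeroSumCount f J (3 * p - 1) = 0 := by
  have hp : p.Prime := Fact.out
  have hp0 := hp.two_le
  have hodd : (-1 : ZMod p) ^ p = -1 := (hp.odd_of_ne_two hp2).neg_one_pow
  have heven : (-1 : ZMod p) ^ (p - 1) = 1 := (hp.even_sub_one hp2).neg_one_pow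
  have hdeg : (1 - (Polynomial.X + 1) ^ (p - 1) : Polynomial (ZMod p)).natDegree ≤ p - 1 := by
    compute_degree!
  have key := sum_neg_one_pow_mul_zeroSumCount f J (1 - (Polynomial.X + 1) ^ (p - 1)) (by omega)
  rw [sum_range_zeroSumCount_of_card_lt f (N := 4 * p) (by omega) (fun n => (-1) ^ n *
    (1 - (Polynomial.X + 1) ^ (p - 1) : Polynomial (ZMod p)).eval (n : ZMod p))] at key
  have h2 := sum_range_ite_mod_eq
    (fun n => (-1) ^ n * (zeroSumCount f J n : ZMod p)) (show p - 1 < p by omega) 4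
  simp only [Polynomial.eval_sub, Polynomial.eval_one, Polynomial.eval_pow, Polynomial.eval_X,
    Polynomial.eval_add,
    one_sub_pow_card_sub_one, natCast_add_one_eq_zero_iff_mod, mul_ite, mul_one, mul_zero, ite_mul,
    zero_mul] at key
  rw [h2] at key
  have h4 : zeroSumCount f J (p * 3 + (p - 1)) = 0 :=
    zeroSumCount_eq_zero_of_card_lt (by omega)
  simp only [sum_range_succ, range_zero, sum_empty, zero_add,
    mul_comm _ p, pow_mul, pow_add, hodd, heven, h4] at key
  rw [← key, show 2 * p - 1 = p + (p - 1) by omega, show 3 * p - 1 = p * 2 + (p - 1) by omega]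
  push_cast
  ring_nf

/-- The weight is the indicator of `n ≡ 0` minus that of `n ≡ -1`. The leading terms cancel, so the
degree drops to `p - 2` and a set with only `3p - 3` elements is allowed. -/
theorem zeroSumCount_alternating_of_three_mul_sub_three (hp2 : p ≠ 2) (f : ι → ZMod p × ZMod p)
    {J : Finset ι} (hJ : #J = 3 * p - 3) :
    (1 : ZMod p) - zeroSumCount f J (p - 1) - zeroSumCount f J p + zeroSumCount f J (2 * p - 1)
      + zeroSumCount f J (2 * p) = 0 := by
  have hp : p.Prime := Fact.out
  have hp0 := hp.two_le
  have hodd : (-1 : ZMod p) ^ p = -1 := (hp.odd_of_ne_two hp2).neg_one_pow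
  have heven : (-1 : ZMod p) ^ (p - 1) = 1 := (hp.even_sub_one hp2).neg_one_pow
  have hdeg : ((Polynomial.X + 1) ^ (p - 1) - Polynomial.X ^ (p - 1) :
      Polynomial (ZMod p)).natDegree ≤ p - 2 := by
    -- Factor the difference of powers: `(X + 1) - X = 1`, leaving a sum of terms of degree `p - 2`.
    have := (Commute.all (Polynomial.X + 1 : Polynomial (ZMod p)) Polynomial.X).mul_geom_sum₂
      (p - 1)
    rw [← this, add_sub_cancel_left, one_mul]
    refine Polynomial.natDegree_sum_le_of_forall_le _ _ fun i hi => ?_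
    have := mem_range.1 hi
    refine Polynomial.natDegree_mul_le.trans ?_
    have h1 : ((Polynomial.X + 1 : Polynomial (ZMod p)) ^ i).natDegree ≤ i := by compute_degree!
    rw [Polynomial.natDegree_X_pow]
    omega
  have key := sum_neg_one_pow_mul_zeroSumCount f J
    ((Polynomial.X + 1) ^ (p - 1) - Polynomial.X ^ (p - 1)) (by omega)
  rw [sum_range_zeroSumCount_of_card_lt f (N := 3 * p) (by omega) (fun n => (-1) ^ n *
    ((Polynomial.X + 1) ^ (p - 1) - Polynomial.X ^ (p - 1) :
      Polynomial (ZMod p)).eval (n : ZMod p))] at key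
  have h1 := sum_range_ite_mod_eq
    (fun n => (-1) ^ n * (zeroSumCount f J n : ZMod p)) hp.pos 3
  have h2 := sum_range_ite_mod_eq
    (fun n => (-1) ^ n * (zeroSumCount f J n : ZMod p)) (show p - 1 < p by omega) 3
  have h3 (n : ℕ) : (-1 : ZMod p) ^ n * ((Polynomial.X + 1) ^ (p - 1) - Polynomial.X ^ (p - 1) :
      Polynomial (ZMod p)).eval (n : ZMod p) * (zeroSumCount f J n : ZMod p)
      = (if n % p = 0 then (-1) ^ n * (zeroSumCount f J n : ZMod p) else 0)
        - (if n % p = p - 1 then (-1) ^ n * (zeroSumCount f J n : ZMod p) else 0) := by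
    have e1 := one_sub_pow_card_sub_one (n : ZMod p)
    have e2 := one_sub_pow_card_sub_one ((n : ZMod p) + 1)
    simp only [natCast_eq_zero_iff_mod] at e1
    simp only [natCast_add_one_eq_zero_iff_mod] at e2
    rw [← mul_boole, ← mul_boole (n % p = p - 1), ← e1, ← e2]
    simp only [Polynomial.eval_sub, Polynomial.eval_one, Polynomial.eval_pow, Polynomial.eval_X,
      Polynomial.eval_add]
    ring
  rw [sum_congr rfl fun n _ => h3 n, sum_sub_distrib, h1, h2] at key
  have h4 : zeroSumCount f J (p * 2 + (p - 1)) = 0 :=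
    zeroSumCount_eq_zero_of_card_lt (by omega)
  simp only [sum_range_succ, range_zero, sum_empty, zero_add, add_zero,
    mul_zero, mul_comm _ p, pow_mul, pow_add, hodd, heven, h4] at key
  rw [zeroSumCount_zero] at key
  rw [← key, show 2 * p - 1 = p + (p - 1) by omega, mul_comm 2 p]
  push_cast
  ring_nf

/-- Lucas' theorem. -/
theorem choose_mul_add_self_cast {a b : ℕ} (hb : b < p) :
    ((a * p + b).choose p : ZMod p) = a := by
  have hp : p.Prime := Fact.out
  have := Choose.choose_modEq_choose_mod_mul_choose_div_nat (p := p) (n := a * p + b) (k := p)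
  rw [Nat.mod_self, Nat.choose_zero_right, one_mul, Nat.div_self hp.pos, Nat.choose_one_right,
    mul_comm a p, Nat.mul_add_div hp.pos, Nat.div_eq_of_lt hb, add_zero] at this
  rw [mul_comm a p]
  exact (ZMod.natCast_eq_natCast_iff _ _ _).2 this

/-- Sum the previous congruence over all `(3p - 3)`-subsets. A zero-sum set of size `n` is counted
`(4p - 3 - n).choose p` times, which is the quotient of `4p - 3 - n` by `p` modulo `p`. -/
theorem zeroSumCount_alternating_of_four_mul_sub_three (hp2 : p ≠ 2) (f : ι → ZMod p × ZMod p)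
    {J : Finset ι} (hJ : #J = 4 * p - 3) :
    (3 : ZMod p) - 2 * zeroSumCount f J (p - 1) - 2 * zeroSumCount f J p
      + zeroSumCount f J (2 * p - 1) + zeroSumCount f J (2 * p) = 0 := by
  have hp : p.Prime := Fact.out
  have hp3 : 3 ≤ p := by have := hp.two_le; omega
  have key : ∑ I ∈ J.powersetCard (3 * p - 3), ((zeroSumCount f I 0 : ZMod p)
      - zeroSumCount f I (p - 1) - zeroSumCount f I p + zeroSumCount f I (2 * p - 1)
      + zeroSumCount f I (2 * p)) = 0 := by
    refine sum_eq_zero fun I hI => ?_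
    rw [zeroSumCount_zero, Nat.cast_one]
    exact zeroSumCount_alternating_of_three_mul_sub_three hp2 f (mem_powersetCard.1 hI).2
  have hsum (n a b : ℕ) (hb : b < p) (hn : n + (a * p + b) = 4 * p - 3) (ha : n ≤ 3 * p - 3) :
      ∑ I ∈ J.powersetCard (3 * p - 3), (zeroSumCount f I n : ZMod p)
        = a * zeroSumCount f J n := by
    rw [← Nat.cast_sum, sum_zeroSumCount_powersetCard f J ha, Nat.cast_mul]
    congr 1
    rw [← choose_mul_add_self_cast (a := a) hb, hJ, ← hn, Nat.add_sub_cancel_left,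
      ← Nat.choose_symm_of_eq_add]
    omega
  simp only [sum_add_distrib, sum_sub_distrib] at key
  rw [hsum 0 3 (p - 3) (by omega) (by omega) (by omega),
    hsum (p - 1) 2 (p - 2) (by omega) (by omega) (by omega),
    hsum p 2 (p - 3) (by omega) (by omega) (by omega),
    hsum (2 * p - 1) 1 (p - 2) (by omega) (by omega) (by omega),
    hsum (2 * p) 1 (p - 3) (by omega) (by omega) (by omega), zeroSumCount_zero] at key
  rw [← key]
  push_cast
  ring

/-- If `p`-element zero-sum subsets are absent, then so are `3 * p`-element ones. -/
theorem zeroSumCount_three_mul_eq_zero (hp2 : p ≠ 2) (f : ι → ZMod p × ZMod p) {J : Finset ι}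
    (h0 : zeroSumCount f J p = 0) : zeroSumCount f J (3 * p) = 0 := by
  have hp : p.Prime := Fact.out
  have hp0 := hp.two_le
  rw [zeroSumCount_eq_zero_iff]
  intro I hIJ hI hsum
  have hI0 := zeroSumCount_eq_zero_of_subset hIJ h0
  obtain ⟨x, hx⟩ : I.Nonempty := card_pos.1 (by omega)
  have hc : #(I.erase x) = 3 * p - 1 := by rw [card_erase_of_mem hx, hI]
  -- With one point removed, the congruence forces a zero-sum `2p`-subset; its complement in `I` is
  -- a zero-sum `p`-subset.
  have key := zeroSumCount_alternating hp2 f (J := I.erase x) (by omega) (by omega)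
  rw [zeroSumCount_eq_zero_of_subset (erase_subset x I) hI0,
    zeroSumCount_eq_zero_of_card_lt (n := 3 * p) (by omega)] at key
  have h2 : zeroSumCount f (I.erase x) (2 * p) ≠ 0 := by
    intro h
    rw [h] at key
    simp at key
  refine h2 (zeroSumCount_eq_zero_iff.2 fun K hK hKc hKs => ?_)
  have hKI : K ⊆ I := hK.trans (erase_subset x I)
  refine zeroSumCount_eq_zero_iff.1 hI0 (I \ K) sdiff_subset ?_ ?_
  · rw [card_sdiff_of_subset hKI]; omega
  · have := sum_sdiff (f := f) hKI
    rwa [hKs, add_zero, hsum] at this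

/-- Double count via `(A, C) ↦ (A ∪ C, C)`, with `C` a zero-sum `2p`-set disjoint from the zero-sum
`(p - 1)`-set `A`. On either side the number of choices of `C` is `-1` mod `p`. -/
theorem zeroSumCount_sub_one_eq (hp2 : p ≠ 2) (f : ι → ZMod p × ZMod p) {J : Finset ι}
    (hJ : #J = 4 * p - 3) (h0 : zeroSumCount f J p = 0) :
    (zeroSumCount f J (p - 1) : ZMod p) = zeroSumCount f J (3 * p - 1) := by
  have hp : p.Prime := Fact.out
  have hp3 : 3 ≤ p := by have := hp.two_le; omega
  have htwo (I : Finset ι) (hIJ : I ⊆ J) (h1 : 3 * p - 2 ≤ #I) (h2 : #I < 3 * p) :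
      (zeroSumCount f I (2 * p) : ZMod p) = -1 := by
    have key := zeroSumCount_alternating hp2 f (J := I) h1 (by omega)
    rw [zeroSumCount_eq_zero_of_subset hIJ h0,
      zeroSumCount_eq_zero_of_card_lt (n := 3 * p) (by omega)] at key
    push_cast at key
    linear_combination key
  have hcount :
      ∑ A ∈ (J.powersetCard (p - 1)).filter (fun A => ∑ i ∈ A, f i = 0),
        zeroSumCount f (J \ A) (2 * p)
      = ∑ B ∈ (J.powersetCard (3 * p - 1)).filter (fun B => ∑ i ∈ B, f i = 0),
        zeroSumCount f B (2 * p) := by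
    simp only [zeroSumCount, ← card_sigma]
    refine card_bij' (fun x _ => ⟨x.1 ∪ x.2, x.2⟩) (fun x _ => ⟨x.1 \ x.2, x.2⟩) ?_ ?_ ?_ ?_
    · rintro ⟨A, C⟩ h
      simp only [mem_sigma, mem_filter, mem_powersetCard] at h ⊢
      obtain ⟨⟨⟨hAJ, hA⟩, hAs⟩, ⟨hCJ, hC⟩, hCs⟩ := h
      have hd : Disjoint A C := disjoint_sdiff.mono_right hCJ
      refine ⟨⟨⟨union_subset hAJ (hCJ.trans sdiff_subset), ?_⟩, ?_⟩,
        ⟨subset_union_right, hC⟩, hCs⟩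
      · rw [card_union_of_disjoint hd]; omega
      · rw [sum_union hd, hAs, hCs, add_zero]
    · rintro ⟨B, C⟩ h
      simp only [mem_sigma, mem_filter, mem_powersetCard] at h ⊢
      obtain ⟨⟨⟨hBJ, hB⟩, hBs⟩, ⟨hCB, hC⟩, hCs⟩ := h
      refine ⟨⟨⟨sdiff_subset.trans hBJ, ?_⟩, ?_⟩, ⟨?_, hC⟩, hCs⟩
      · rw [card_sdiff_of_subset hCB]; omega
      · have := sum_sdiff (f := f) hCB
        rwa [hCs, add_zero, hBs] at this
      · intro x hx
        simp [hBJ (hCB hx), hx]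
    · rintro ⟨A, C⟩ h
      simp only [mem_sigma, mem_filter, mem_powersetCard] at h
      have hd : Disjoint A C := disjoint_sdiff.mono_right h.2.1.1
      simp only [union_sdiff_cancel_right hd]
    · rintro ⟨B, C⟩ h
      simp only [mem_sigma, mem_filter, mem_powersetCard] at h
      simp only [sdiff_union_of_subset h.2.1.1]
  have hl : ∑ A ∈ (J.powersetCard (p - 1)).filter (fun A => ∑ i ∈ A, f i = 0),
      (zeroSumCount f (J \ A) (2 * p) : ZMod p) = - zeroSumCount f J (p - 1) := by
    rw [sum_congr rfl (g := fun _ => (-1 : ZMod p)), sum_const, nsmul_eq_mul, mul_neg_one,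
      ← zeroSumCount]
    intro A hA
    simp only [mem_filter, mem_powersetCard] at hA
    have := card_sdiff_of_subset hA.1.1
    exact htwo _ sdiff_subset (by omega) (by omega)
  have hr : ∑ B ∈ (J.powersetCard (3 * p - 1)).filter (fun B => ∑ i ∈ B, f i = 0),
      (zeroSumCount f B (2 * p) : ZMod p) = - zeroSumCount f J (3 * p - 1) := by
    rw [sum_congr rfl (g := fun _ => (-1 : ZMod p)), sum_const, nsmul_eq_mul, mul_neg_one,
      ← zeroSumCount]
    intro B hB
    simp only [mem_filter, mem_powersetCard] at hB
    exact htwo _ hB.1.1 (by omega) (by omega)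
  have := congrArg (Nat.cast (R := ZMod p)) hcount
  push_cast at this
  rw [hl, hr] at this
  exact neg_injective this

/-- **Reiher's theorem** (the Kemnitz conjecture): among `4 * p - 3` elements of `(ZMod p)²`, for
an odd prime `p`, there are `p` which sum to zero. -/
theorem exists_subset_card_eq_prime_sum_eq_zero (hp2 : p ≠ 2) (f : ι → ZMod p × ZMod p)
    {J : Finset ι} (hJ : 4 * p - 3 ≤ #J) : ∃ I ⊆ J, #I = p ∧ ∑ i ∈ I, f i = 0 := by
  have hp : p.Prime := Fact.out
  have hp3 : 3 ≤ p := by have := hp.two_le; omega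
  obtain ⟨K, hKJ, hK⟩ := exists_subset_card_eq hJ
  by_contra! hno
  have h0 : zeroSumCount f K p = 0 :=
    zeroSumCount_eq_zero_iff.2 fun I hI => hno I (hI.trans hKJ)
  have e1 := zeroSumCount_alternating hp2 f (J := K) (by omega) (by omega)
  have e2 := zeroSumCount_alternating_sub_one hp2 f (J := K) (by omega) (by omega)
  have e3 := zeroSumCount_alternating_of_four_mul_sub_three hp2 f hK
  have e4 := zeroSumCount_sub_one_eq hp2 f hK h0
  rw [h0, zeroSumCount_three_mul_eq_zero hp2 f h0] at e1
  rw [h0] at e3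
  push_cast at e1 e3
  have : (2 : ZMod p) = 0 := by linear_combination e3 - e1 + e2 + e4
  have h2 := (ZMod.natCast_eq_zero_iff 2 p).1 (by exact_mod_cast this)
  exact absurd (Nat.le_of_dvd (by norm_num) h2) (by omega)

end Prime

/-! ### From primes to divisors: disjoint blocks -/

/-- If every large enough subset of `J` contains a `t`-element set satisfying `Q`, then a larger `J`
contains many pairwise disjoint ones. -/
theorem exists_pairwiseDisjoint_of_forall_exists_subset {ι : Type*} [DecidableEq ι]
    {Q : Finset ι → Prop} {N t : ℕ} {J : Finset ι}
    (hQ : ∀ K ⊆ J, N ≤ #K → ∃ I ⊆ K, #I = t ∧ Q I) (j : ℕ) (hJ : N + t * j ≤ #J + t) :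
    ∃ F : ℕ → Finset ι, (∀ m ∈ range j, F m ⊆ J ∧ #(F m) = t ∧ Q (F m)) ∧
      (range j : Set ℕ).PairwiseDisjoint F := by
  induction j with
  | zero => exact ⟨fun _ => ∅, by simp, by simp⟩
  | succ j ih =>
    rw [Nat.mul_succ] at hJ
    obtain ⟨F, hF, hd⟩ := ih (by omega)
    have hU : (range j).biUnion F ⊆ J := biUnion_subset.2 fun m hm => (hF m hm).1
    have hUc : #((range j).biUnion F) = t * j := by
      rw [card_biUnion hd, sum_congr rfl fun m hm => (hF m hm).2.1]
      simp [mul_comm]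
    obtain ⟨I, hI, hIt, hIQ⟩ := hQ (J \ (range j).biUnion F) sdiff_subset (by
      rw [card_sdiff_of_subset hU]; omega)
    have hdI : ∀ m ∈ range j, Disjoint I (F m) := fun m hm =>
      disjoint_of_subset_left hI
        (disjoint_sdiff_self_left.mono_right (subset_biUnion_of_mem F hm))
    have hFj : ∀ m ∈ range j, (Function.update F j I) m = F m := fun m hm =>
      Function.update_of_ne (mem_range.1 hm).ne _ _
    refine ⟨Function.update F j I, fun m hm => ?_, ?_⟩
    · rw [range_add_one, mem_insert] at hm
      rcases hm with rfl | hm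
      · rw [Function.update_self]
        exact ⟨hI.trans sdiff_subset, hIt, hIQ⟩
      · rw [hFj m hm]
        exact hF m hm
    · rw [range_add_one, coe_insert]
      refine Set.PairwiseDisjoint.insert ?_ ?_
      · intro m hm m' hm' hne
        simp only [Function.onFun]
        rw [hFj m hm, hFj m' hm']
        exact hd hm hm' hne
      · intro m hm _
        rw [hFj m hm, Function.update_self]
        exact hdI m hm

/-- For odd `r ∣ k`, among any `2 * r + 2 * k - 3` pairs of integers there are `k` whose sum is
divisible by `r` in the first and by `k` in the second coordinate. -/
theorem Int.exists_subset_card_eq_dvd_sum_and_dvd_sum {r : ℕ} (hr : Odd r) {k : ℕ} (hrk : r ∣ k)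
    (hk : k ≠ 0) {ι : Type} [DecidableEq ι] (a b : ι → ℤ) {J : Finset ι}
    (hJ : 2 * r + 2 * k - 3 ≤ #J) :
    ∃ I ⊆ J, #I = k ∧ (r : ℤ) ∣ ∑ i ∈ I, a i ∧ (k : ℤ) ∣ ∑ i ∈ I, b i := by
  induction r using induction_on_primes generalizing k ι with
  | zero => simp at hr
  | one =>
    obtain ⟨I, hIJ, hI, h⟩ := Int.erdos_ginzburg_ziv (s := J) (n := k) b (by omega)
    exact ⟨I, hIJ, hI, by simp, h⟩
  | prime_mul p r hp ih =>
    have : Fact p.Prime := ⟨hp⟩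
    obtain ⟨hpo, hro⟩ := Nat.odd_mul.1 hr
    have hp2 : p ≠ 2 := by rintro rfl; exact absurd hpo (by decide)
    obtain ⟨q, rfl⟩ : p ∣ k := (dvd_mul_right p r).trans hrk
    have hrq : r ∣ q := Nat.dvd_of_mul_dvd_mul_left hp.pos hrk
    have hq : q ≠ 0 := right_ne_zero_of_mul hk
    have hr0 : 0 < r := hro.pos
    have hp3 : 3 ≤ p := by have := hp.two_le; omega
    obtain ⟨F, hF, hd⟩ := exists_pairwiseDisjoint_of_forall_exists_subset (N := 4 * p - 3) (t := p)
      (J := J) (Q := fun I => (p : ℤ) ∣ ∑ i ∈ I, a i ∧ (p : ℤ) ∣ ∑ i ∈ I, b i) (by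
        intro K _ hK
        obtain ⟨I, hI, hIp, hs⟩ := exists_subset_card_eq_prime_sum_eq_zero hp2
          (fun i => ((a i : ZMod p), (b i : ZMod p))) hK
        refine ⟨I, hI, hIp, ?_⟩
        rw [Prod.ext_iff, Prod.fst_sum, Prod.snd_sum] at hs
        simpa [← Int.cast_sum, ZMod.intCast_zmod_eq_zero_iff_dvd] using hs)
      -- Extracting this many blocks greedily needs `4p - 3 + p(2r + 2q - 4) = 2pr + 2pq - 3` pairs,
      -- exactly the hypothesis.
      (2 * r + 2 * q - 3) (by
        have e : p * (2 * r + 2 * q - 3) + 3 * p = 2 * (p * r) + 2 * (p * q) := by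
          have h1 : 2 * r + 2 * q - 3 + 3 = 2 * r + 2 * q := by omega
          linear_combination p * h1
        omega)
    -- The blocks become the new terms, with their sums divided by `p`.
    obtain ⟨I, hI, hIq, ha, hb⟩ := ih hro hrq hq (fun m => (∑ i ∈ F m, a i) / p)
      (fun m => (∑ i ∈ F m, b i) / p) (J := Finset.range (2 * r + 2 * q - 3)) (by simp)
    have hdI : (I : Set ℕ).PairwiseDisjoint F := hd.subset (coe_subset.2 hI)
    refine ⟨I.biUnion F, biUnion_subset.2 fun m hm => (hF m (hI hm)).1, ?_, ?_, ?_⟩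
    · rw [card_biUnion hdI, sum_congr rfl fun m hm => (hF m (hI hm)).2.1, sum_const, hIq,
        smul_eq_mul, mul_comm]
    · rw [sum_biUnion hdI, ← sum_congr rfl fun m hm =>
        Int.mul_ediv_cancel' (hF m (hI hm)).2.2.1, ← mul_sum, Nat.cast_mul]
      exact mul_dvd_mul_left _ ha
    · rw [sum_biUnion hdI, ← sum_congr rfl fun m hm =>
        Int.mul_ediv_cancel' (hF m (hI hm)).2.2.2, ← mul_sum, Nat.cast_mul]
      exact mul_dvd_mul_left _ hb

/-! ### The second symmetric function and the upper bound -/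

theorem Multiset.esymm_cons_two {R : Type*} [CommRing R] (a : R) (s : Multiset R) :
    (a ::ₘ s).esymm 2 = s.esymm 2 + a * s.sum := by
  have := Multiset.sum_map_mul_left (s := s) (a := a) (f := id)
  simp only [id_eq, Multiset.map_id'] at this
  simp [Multiset.esymm, Multiset.powersetCard_cons, Multiset.powersetCard_one, Multiset.map_map,
    this]

theorem Multiset.sum_sq_eq_add_two_mul_esymm {R : Type*} [CommRing R] (s : Multiset R) :
    s.sum ^ 2 = (s.map (· ^ 2)).sum + 2 * s.esymm 2 := by
  induction s using Multiset.induction with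
  | empty =>
    rw [Multiset.esymm, Multiset.powersetCard_eq_empty _ (by simp)]
    simp
  | cons a s ih =>
    rw [Multiset.esymm_cons_two, Multiset.sum_cons, Multiset.map_cons, Multiset.sum_cons]
    linear_combination ih

theorem Multiset.esymm_two_add_replicate_zero {R : Type*} [CommRing R] (s : Multiset R) (n : ℕ) :
    (s + Multiset.replicate n 0).esymm 2 = s.esymm 2 := by
  induction n with
  | zero => simp
  | succ n ih =>
    rw [Multiset.replicate_succ, Multiset.add_cons, Multiset.esymm_cons_two, ih, zero_mul, add_zero]

theorem Multiset.exists_eq_add_replicate_of_le_add_replicate {α : Type*} [DecidableEq α] {n : ℕ}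
    {a : α} {s t : Multiset α} (h : t ≤ s + Multiset.replicate n a) :
    ∃ u ≤ s, ∃ m ≤ n, t = u + Multiset.replicate m a := by
  obtain ⟨m, hm, he⟩ := Multiset.le_replicate_iff.1
    (Multiset.inter_le_right : t ∩ Multiset.replicate n a ≤ _)
  refine ⟨t - Multiset.replicate n a, tsub_le_iff_right.2 h, m, hm, ?_⟩
  rw [← he, Multiset.sub_add_inter]

theorem isUnit_two_of_odd {k : ℕ} (hk : Odd k) : IsUnit (2 : ZMod k) := by
  have := (ZMod.isUnit_iff_coprime 2 k).2 hk.coprime_two_left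
  exact_mod_cast this

theorem exists_le_card_eq_esymm_two_eq_zero {k r : ℕ} (hk : Odd k) (hrk : r ∣ k) (hkr : k ∣ r ^ 2)
    (l : ℕ) (hl : 1 ≤ l) (S : Multiset (ZMod k)) (hS : (l + 1) * k + 2 * r - 3 ≤ S.card) :
    ∃ S' ≤ S, S'.card = l * k ∧ S'.esymm 2 = 0 := by
  have hk0 : k ≠ 0 := hk.pos.ne'
  have : NeZero k := ⟨hk0⟩
  have hro : Odd r := hk.of_dvd_nat hrk
  have hr0 := hro.pos
  let a : ZMod k × ℕ → ℤ := fun x => (x.1.val : ℤ)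
  obtain ⟨F, hF, hd⟩ := exists_pairwiseDisjoint_of_forall_exists_subset
    (N := 2 * r + 2 * k - 3) (t := k) (J := S.toEnumFinset)
    (Q := fun I => (r : ℤ) ∣ ∑ i ∈ I, a i ∧ (k : ℤ) ∣ ∑ i ∈ I, a i ^ 2)
    (fun K _ hK => Int.exists_subset_card_eq_dvd_sum_and_dvd_sum hro hrk hk0 a (fun i => a i ^ 2) hK)
    l (by
      rw [Multiset.card_toEnumFinset]
      have e : (l + 1) * k = k * l + k := by ring
      have : k ≤ k * l := Nat.le_mul_of_pos_right k hl
      have := hk.pos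
      omega)
  set I := (range l).biUnion F with hI
  have hIS : I ⊆ S.toEnumFinset := biUnion_subset.2 fun m hm => (hF m hm).1
  refine ⟨I.1.map Prod.fst, Multiset.map_fst_le_of_subset_toEnumFinset hIS, ?_, ?_⟩
  · rw [Multiset.card_map, ← card_def, card_biUnion hd, sum_congr rfl fun m hm => (hF m hm).2.1,
      sum_const, card_range, smul_eq_mul]
  · have h1 : (r : ℤ) ∣ ∑ i ∈ I, a i := by
      rw [sum_biUnion hd]; exact dvd_sum fun m hm => (hF m hm).2.2.1
    have h2 : (k : ℤ) ∣ ∑ i ∈ I, a i ^ 2 := by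
      rw [sum_biUnion hd]; exact dvd_sum fun m hm => (hF m hm).2.2.2
    have h3 : (k : ℤ) ∣ (∑ i ∈ I, a i) ^ 2 :=
      (by exact_mod_cast hkr : (k : ℤ) ∣ (r : ℤ) ^ 2).trans (pow_dvd_pow_of_dvd h1 2)
    rw [← ZMod.intCast_zmod_eq_zero_iff_dvd] at h2 h3
    have h4 := Multiset.sum_sq_eq_add_two_mul_esymm (I.1.map Prod.fst)
    have ha (x : ZMod k × ℕ) : ((a x : ℤ) : ZMod k) = x.1 := by simp [a]
    push_cast at h2 h3
    simp only [ha] at h2 h3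
    rw [Multiset.map_map] at h4
    change (∑ i ∈ I, i.1) ^ 2 = (∑ i ∈ I, i.1 ^ 2) + _ at h4
    rw [h2, h3, zero_add] at h4
    exact (isUnit_two_of_odd hk).mul_right_eq_zero.1 h4.symm

theorem egzConst_mul_two_le {k r : ℕ} (hk : Odd k) (hrk : r ∣ k) (hkr : k ∣ r ^ 2)
    (l : ℕ) (hl : 1 ≤ l) :
    egzConst (l * k) (ZMod k) 2 ≤ (((l + 1) * k + 2 * r - 3 : ℕ) : ℕ∞) := by
  refine sInf_le ⟨_, ⟨?_, exists_le_card_eq_esymm_two_eq_zero hk hrk hkr l hl⟩, rfl⟩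
  have h1 := hk.pos
  have h2 := (hk.of_dvd_nat hrk).pos
  have : 1 * k ≤ l * k := Nat.mul_le_mul_right k hl
  rw [add_mul]
  omega

/-! ### Lower bounds -/

theorem add_davenportConst_two_sub_two_le_egzConst (R : Type*) [CommRing R] {k : ℕ} (hk : 2 ≤ k) :
    (k : ℕ∞) + davenportConst 2 R - 2 ≤ egzConst k R 2 := by
  classical
  refine le_sInf ?_
  rintro _ ⟨z, ⟨-, hz⟩, rfl⟩
  have hkz : k ≤ z := by
    obtain ⟨T, hT, hTc, -⟩ := hz (Multiset.replicate z 0) (by simp)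
    simpa [hTc] using Multiset.card_le_card hT
  have hD : davenportConst 2 R ≤ ((z + 2 - k : ℕ) : ℕ∞) := by
    refine sInf_le ⟨_, ⟨by omega, fun S hS => ?_⟩, rfl⟩
    -- Only `k - 2` zeros are added, so at least two of the `k` terms of `T` come from `S`.
    obtain ⟨T, hT, hTc, hT0⟩ := hz (S + Multiset.replicate (k - 2) 0) (by simp; omega)
    obtain ⟨U, hU, m, hm, rfl⟩ := Multiset.exists_eq_add_replicate_of_le_add_replicate hT
    rw [Multiset.card_add, Multiset.card_replicate] at hTc
    exact ⟨U, hU, by omega, by rwa [Multiset.esymm_two_add_replicate_zero] at hT0⟩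
  calc (k : ℕ∞) + davenportConst 2 R - 2 ≤ k + ((z + 2 - k : ℕ) : ℕ∞) - 2 := by gcongr
    _ = ((k + (z + 2 - k) - 2 : ℕ) : ℕ∞) := by push_cast; rfl
    _ = z := by congr 1; omega

theorem lt_davenportConst_of_forall_esymm_ne_zero {R : Type*} [CommRing R] {m : ℕ}
    {S : Multiset R} (h : ∀ T ≤ S, m ≤ T.card → T.esymm m ≠ 0) :
    ((S.card + 1 : ℕ) : ℕ∞) ≤ davenportConst m R := by
  refine le_sInf ?_
  rintro _ ⟨z, ⟨-, hz⟩, rfl⟩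
  have : ¬ z ≤ S.card := fun hle => by
    obtain ⟨T, hT, hTc, hT0⟩ := hz S hle
    exact h T hT hTc hT0
  simp only [Nat.cast_le]
  omega

theorem eight_mul_esymm_two_replicate {R : Type*} [CommRing R] {c : R} (hc : 2 * c = 1) (i j : ℕ) :
    8 * (Multiset.replicate j 1 + Multiset.replicate i c).esymm 2
      = ((2 * j + i) ^ 2 - 4 * j - i : R) := by
  have := Multiset.sum_sq_eq_add_two_mul_esymm (Multiset.replicate j 1 + Multiset.replicate i c)
  simp only [Multiset.sum_add, Multiset.sum_replicate, Multiset.map_add, Multiset.map_replicate,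
    nsmul_eq_mul, one_pow, mul_one] at this
  linear_combination (-4) * this + ((4 * j * i : R) + i ^ 2 * (2 * c + 1) - i * (2 * c + 1)) * hc

section Prime

variable {p : ℕ} [Fact p.Prime]

/-- Short multisets of halves added to `p - 1` ones have no subsequence killed by `e_2`, as long as
no value of the quadratic form involved vanishes. -/
theorem add_le_davenportConst_two (hp2 : p ≠ 2) (n : ℕ)
    (h : ∀ i ≤ n, ∀ j < p, 2 ≤ j + i → ((2 * j + i) ^ 2 - 4 * j - i : ZMod p) ≠ 0) :
    ((p + n : ℕ) : ℕ∞) ≤ davenportConst 2 (ZMod p) := by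
  have hp : p.Prime := Fact.out
  obtain ⟨c, hc⟩ := (isUnit_two_of_odd (hp.odd_of_ne_two hp2)).exists_right_inv
  have hS := lt_davenportConst_of_forall_esymm_ne_zero (m := 2)
    (S := Multiset.replicate (p - 1) (1 : ZMod p) + Multiset.replicate n c) (by
      intro T hT hTc hT0
      obtain ⟨U, hU, i, hi, rfl⟩ := Multiset.exists_eq_add_replicate_of_le_add_replicate hT
      obtain ⟨j, hj, rfl⟩ := Multiset.le_replicate_iff.1 hU
      have := hp.pos
      refine h i hi j (by omega) (by simpa using hTc) ?_
      rw [← eight_mul_esymm_two_replicate hc, hT0, mul_zero])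
  rw [Multiset.card_add, Multiset.card_replicate, Multiset.card_replicate] at hS
  have := hp.pos
  rwa [show p - 1 + n + 1 = p + n by omega] at hS

theorem natCast_ne_zero_of_pos_of_lt {j : ℕ} (h0 : 0 < j) (h : j < p) : (j : ZMod p) ≠ 0 := by
  rw [Ne, ZMod.natCast_eq_zero_iff]
  exact fun hd => absurd (Nat.le_of_dvd h0 hd) (by omega)

theorem quadratic_ne_zero_of_le_one (hp2 : p ≠ 2) {i j : ℕ} (hi : i ≤ 1) (hj : j < p)
    (hij : 2 ≤ j + i) : ((2 * j + i) ^ 2 - 4 * j - i : ZMod p) ≠ 0 := by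
  have h2 : (2 : ZMod p) ≠ 0 :=
    (isUnit_two_of_odd ((Fact.out : p.Prime).odd_of_ne_two hp2)).ne_zero
  have hj0 : (j : ZMod p) ≠ 0 := natCast_ne_zero_of_pos_of_lt (by omega) hj
  interval_cases i
  -- For `i = 0` the form is `4j(j - 1)`; for `i = 1` it is `4j ^ 2`.
  · have hj1 : (j : ZMod p) - 1 ≠ 0 := by
      have := natCast_ne_zero_of_pos_of_lt (p := p) (j := j - 1) (by omega) (by omega)
      rwa [Nat.cast_sub (by omega), Nat.cast_one] at this
    have := mul_ne_zero (mul_ne_zero (mul_ne_zero h2 h2) hj0) hj1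
    contrapose! this
    push_cast at this
    linear_combination this
  · have := mul_ne_zero (mul_ne_zero (mul_ne_zero h2 h2) hj0) hj0
    contrapose! this
    push_cast at this
    linear_combination this

/-- The form equals `2(j ^ 2 + (j + 1) ^ 2)`; a zero would make `-1` a square unless `j = 0`, where
the bracket is `1`. -/
theorem quadratic_two_ne_zero (hp4 : p % 4 = 3) (j : ℕ) :
    ((2 * j + (2 : ℕ)) ^ 2 - 4 * j - (2 : ℕ) : ZMod p) ≠ 0 := by
  have h2 : (2 : ZMod p) ≠ 0 :=
    (isUnit_two_of_odd ((Fact.out : p.Prime).odd_of_ne_two (by omega))).ne_zero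
  intro h
  have hsum : (2 : ZMod p) * ((j : ZMod p) ^ 2 + (j + 1) ^ 2) = 0 := by
    push_cast at h
    linear_combination h
  have hs := (mul_eq_zero.1 hsum).resolve_left h2
  have hj : (j : ZMod p) = 0 := by
    by_contra hj0
    refine ZMod.mod_four_ne_three_of_sq_eq_neg_one (p := p) (y := (j + 1) / j) ?_ hp4
    field_simp
    linear_combination hs
  rw [hj] at hs
  simp at hs

end Prime

theorem two_mul_le_of_davenportConst_le {p n : ℕ} (hp : 2 ≤ p) {R : Type*} [CommRing R]
    (h : ((p + n : ℕ) : ℕ∞) ≤ davenportConst 2 R) :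
    ((2 * p + n - 2 : ℕ) : ℕ∞) ≤ egzConst p R 2 := by
  refine le_trans ?_ (add_davenportConst_two_sub_two_le_egzConst R hp)
  calc ((2 * p + n - 2 : ℕ) : ℕ∞) = (p : ℕ∞) + ((p + n : ℕ) : ℕ∞) - 2 := by
        rw [show 2 * p + n - 2 = p + (p + n) - 2 by omega]; push_cast; rfl
    _ ≤ _ := by gcongr

end

theorem mainTheorem5 (k : ℕ) (hk : Odd k) :
    (∀ ℓ r : ℕ, 1 ≤ ℓ → r ∣ k → k ∣ r ^ 2 →
      egzConst (ℓ * k) (ZMod k) 2 ≤ (((ℓ + 1) * k + 2 * r - 3 : ℕ) : ℕ∞)) ∧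
    (∀ r : ℕ, k = r ^ 2 →
      egzConst k (ZMod k) 2 ≤ ((2 * r ^ 2 + 2 * r - 3 : ℕ) : ℕ∞)) ∧
    (k : ℕ∞) + davenportConst 2 (ZMod k) - 2 ≤ egzConst k (ZMod k) 2 ∧
    (k.Prime →
      ((2 * k - 1 : ℕ) : ℕ∞) ≤ egzConst k (ZMod k) 2 ∧
      (k % 4 = 3 → ((2 * k : ℕ) : ℕ∞) ≤ egzConst k (ZMod k) 2)) := by
  refine ⟨fun l r hl hrk hkr => egzConst_mul_two_le hk hrk hkr l hl, ?_, ?_, fun hp => ?_⟩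
  · rintro r rfl
    simpa [one_add_one_eq_two] using
      egzConst_mul_two_le hk (dvd_pow_self r two_ne_zero) dvd_rfl 1 le_rfl
  · obtain rfl | hk2 : k = 1 ∨ 2 ≤ k := by have := hk.pos; omega
    -- For `k = 1` zero padding is unavailable, but the bound reads `1 + 2 - 2 = 1` and the constant
    -- is positive.
    · have hD : davenportConst 2 (ZMod 1) ≤ 2 :=
        sInf_le ⟨2, ⟨two_pos, fun S hS => ⟨S, le_rfl, hS, Subsingleton.elim _ _⟩⟩, rfl⟩
      calc ((1 : ℕ) : ℕ∞) + davenportConst 2 (ZMod 1) - 2 ≤ ((1 : ℕ) : ℕ∞) + 2 - 2 := by gcongr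
        _ = 1 := rfl
        _ ≤ _ := le_sInf (by rintro _ ⟨z, ⟨hz, -⟩, rfl⟩; exact Nat.one_le_cast.2 hz)
    · exact add_davenportConst_two_sub_two_le_egzConst _ hk2
  · have : Fact k.Prime := ⟨hp⟩
    have hk2 : k ≠ 2 := by rintro rfl; exact absurd hk (by decide)
    refine ⟨?_, fun hk4 => ?_⟩
    · exact two_mul_le_of_davenportConst_le hp.two_le
        (add_le_davenportConst_two hk2 1 fun i hi j hj => quadratic_ne_zero_of_le_one hk2 hi hj)
    · refine two_mul_le_of_davenportConst_le (n := 2) hp.two_le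
        (add_le_davenportConst_two hk2 2 fun i hi j hj hij => ?_)
      obtain rfl | hi : i = 2 ∨ i ≤ 1 := by omega
      · exact quadratic_two_ne_zero hk4 j
      · exact quadratic_ne_zero_of_le_one hk2 hi hj hij
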